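/- **Setting.** Let $\mathbf V=\mathbf L\cup\mathbf X$ be a finite set of discrete random variables, where the variables in $\mathbf L$ are latent and those in $\mathbf X$ are observed. Each variable $V$ takes finitely many, and at least two, values, each with positive probability. Let $\mathcal G$ be a directed acyclic graph on $\mathbf V$. Assume that this is a *discrete latent structure model*: - there is no edge between observed variables, and no edge from an observed to a latent variable; - each observed variable has exactly one latent parent (it is pure); - each latent variable has at least three observed children; - each observed variable has strictly more values than each latent variable. The edges among the latent variables are otherwise arbitrary. Assume moreover: - (Causal Markov) each variable is independent of its non-descendants given its parents; - (Faithfulness) each conditional independence $A\perp B\mid C$ between disjoint sets of variables that holds in the joint distribution $\mathbb P$ is entailed by the causal Markov condition applied to $\mathcal G$, that is, holds in every discrete distribution on $\mathbf V$ that is Markov with respect to $\mathcal G$; - (Full rank) for each observed $X$ with parent set $\mathrm{Pa}_X$, the columns of the table $\mathbb P(X\mid \mathrm{Pa}_X)$ (one column per value of $\mathrm{Pa}_X$) are linearly independent. Assume that all latent variables have the same number $r$ of values. For observed variables $X_1,\dots,X_n$ let $\mathcal T_{(X_1,\dots,X_n)}$ be the $n$-way tensor of their joint probabilities, and let $\mathrm{Rank}$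 be the tensor rank over $\mathbb R$, i.e. the smallest number of outer products of $n$ vectors that sum to the tensor. **Proposition (Identification of causal cluster).** Let $X_i,X_j,X_k\in\mathbf X$ be three distinct observed variables. - *Rule 1.* If $\mathrm{Rank}(\mathcal T_{(X_i,X_j,X_k)})\neq r$, then $X_i,X_j,X_k$ belong to different latent parents: they do not all share one latent parent, and in fact no two of them share a latent parent. - *Rule 2.* Suppose that $\mathrm{Rank}(\mathcal T_{(X_i,X_j,X_k)})\neq 1$ (that is, $X_i,X_j,X_k$ are not mutually independent; since $r\ge 2$, this holds in particular if $\mathrm{Rank}(\mathcal T_{(X_i,X_j,X_k)})=r$, i.e. if Rule 1 does not apply). If $\mathrm{Rank}(\mathcal T_{(X_i,X_j,X_k,X_s)})=r$ for every $X_s\in\mathbf X\setminus\{X_i,X_j,X_k\}$, then $X_i,X_j,X_k$ share the same latent parent. -/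

import Mathlib

noncomputable section

namespace DiscreteLSM

/-! ### Tensors and tensor rank -/

/-- The outer product `u 0 ⊗ ⋯ ⊗ u (n - 1)` of `n` vectors, i.e. a rank-one `n`-way tensor of
format `d 0 × ⋯ × d (n - 1)`. -/
def outerProduct {n : ℕ} {d : Fin n → ℕ} (u : ∀ m, Fin (d m) → ℝ) : (∀ m, Fin (d m)) → ℝ :=
  fun a => ∏ m, u m (a m)

/-- The rank of a real `n`-way tensor (`n ≥ 1`): the smallest number of rank-one tensors that sum
to it. -/
def tensorRank {n : ℕ} {d : Fin n → ℕ} (T : (∀ m, Fin (d m)) → ℝ) : ℕ :=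
  sInf {R : ℕ | ∃ u : Fin R → ∀ m, Fin (d m) → ℝ, T = ∑ t, outerProduct (u t)}

/-! ### Joint distributions of finitely many discrete variables -/

section Dist

variable {V : Type*} [Fintype V] [DecidableEq V]

/-- A joint value of all variables; the variable `v` takes values in `Fin (c v)`. -/
abbrev Config (c : V → ℕ) : Type _ := ∀ v, Fin (c v)

/-- A joint probability mass function of the variables. -/
structure JointDist (c : V → ℕ) where
  prob : Config c → ℝ
  nonneg : ∀ x, 0 ≤ prob x
  sum_eq_one : ∑ x, prob x = 1

variable {c : V → ℕ}

open Classical in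
/-- The probability of an event. -/
def JointDist.pr (P : JointDist c) (E : Set (Config c)) : ℝ :=
  ∑ x, if x ∈ E then P.prob x else 0

/-- `P.marg S x` is the probability that every variable `v` in `S` takes the value `x v`. -/
def JointDist.marg (P : JointDist c) (S : Set V) (x : Config c) : ℝ :=
  P.pr {y | ∀ v ∈ S, y v = x v}

/-- The sets of variables `A` and `B` are conditionally independent given `C`:
`P(A, B, C) P(C) = P(A, C) P(B, C)`. -/
def JointDist.CondIndep (P : JointDist c) (A B C : Set V) : Prop :=
  ∀ x : Config c,
    P.marg (A ∪ B ∪ C) x * P.marg C x = P.marg (A ∪ C) x * P.marg (B ∪ C) x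

/-- The probability tensor of the variables `v 0, …, v (n - 1)`. -/
def JointDist.tensor (P : JointDist c) {n : ℕ} (v : Fin n → V) : (∀ m, Fin (c (v m))) → ℝ :=
  fun a => P.pr {y | ∀ m, y (v m) = a m}

end Dist

/-! ### Causal graphs -/

section Graph

variable {V : Type*} (G : Digraph V)

/-- There is no directed cycle. -/
def Acyclic : Prop := ∀ v, ¬ Relation.TransGen G.Adj v v

def parents (v : V) : Set V := {u | G.Adj u v}

/-- The descendants of `v`, with `v` itself counted as one of them. -/
def descendants (v : V) : Set V := {w | Relation.ReflTransGen G.Adj v w}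

variable [Fintype V] [DecidableEq V]

/-- The causal Markov condition: each variable is independent of its non-descendants given its
parents. -/
def IsMarkov {c : V → ℕ} (P : JointDist c) : Prop :=
  ∀ v, P.CondIndep {v} (descendants G v)ᶜ (parents G v)

/-- The relation `A ⊥ B | C` is entailed by the causal Markov condition applied to `G`: it holds in
every discrete distribution of the vertices that satisfies this condition. -/
def Entails (A B C : Set V) : Prop :=
  ∀ (c : V → ℕ) (P : JointDist c), IsMarkov G P → P.CondIndep A B C

/-- Faithfulness: each conditional independence relation (between disjoint sets of variables) that
is true in `P` is entailed by the causal Markov condition applied to `G`. -/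
def IsFaithful {c : V → ℕ} (P : JointDist c) : Prop :=
  ∀ A B C : Set V, Disjoint A B → Disjoint A C → Disjoint B C →
    P.CondIndep A B C → Entails G A B C

/-- The conditional probability `P(v = a | parents of v = π)`. -/
def condProb {c : V → ℕ} (P : JointDist c) (v : V) (π : ∀ u : parents G v, Fin (c u))
    (a : Fin (c v)) : ℝ :=
  P.pr {y | y v = a ∧ ∀ u : parents G v, y u = π u} / P.pr {y | ∀ u : parents G v, y u = π u}

/-- The table `P(v | parents of v)`, with one column for each joint value of the parents, has
linearly independent columns. -/
def FullRankAt {c : V → ℕ} (P : JointDist c) (v : V) : Prop :=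
  LinearIndependent ℝ (fun π : (∀ u : parents G v, Fin (c u)) => condProb G P v π)

end Graph

/-! ### The discrete latent structure model -/

section Model

variable {L X : Type*}

/-- A discrete latent structure model with latent variables `L` and observed variables `X`; the
variable `v` has the state space `Fin (c v)`, and every state has positive probability. -/
structure IsDiscreteLSM [Fintype L] [DecidableEq L] [Fintype X] [DecidableEq X]
    (G : Digraph (L ⊕ X)) (c : L ⊕ X → ℕ) (P : JointDist c) : Prop where
  acyclic : Acyclic G
  two_le_card : ∀ v, 2 ≤ c v
  state_pos : ∀ (v : L ⊕ X) (a : Fin (c v)), 0 < P.pr {y | y v = a}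
  /-- There are no edges between observed variables. -/
  no_edge_observed : ∀ x x' : X, ¬ G.Adj (Sum.inr x) (Sum.inr x')
  /-- Observed variables measure latent ones; they are not causes of latent variables. -/
  no_edge_to_latent : ∀ (x : X) (l : L), ¬ G.Adj (Sum.inr x) (Sum.inl l)
  /-- Observed variables are pure: each has exactly one latent parent. -/
  pure_observed : ∀ x : X, ∃! l : L, G.Adj (Sum.inl l) (Sum.inr x)
  /-- Each latent variable has at least three (pure) observed children. -/
  three_children : ∀ l : L, 3 ≤ {x : X | G.Adj (Sum.inl l) (Sum.inr x)}.ncard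
  /-- Observed variables have larger support than latent variables. -/
  sufficient_observation : ∀ (l : L) (x : X), c (Sum.inl l) < c (Sum.inr x)

/-- A set of observed variables is a causal cluster: its members share a common latent parent. -/
def IsCausalCluster (G : Digraph (L ⊕ X)) (S : Set X) : Prop :=
  ∃ l : L, ∀ x ∈ S, G.Adj (Sum.inl l) (Sum.inr x)

end Model

end DiscreteLSM

end

/-! Given its latent parent `l`, an observed variable is independent of all other variables. By full
rank, the columns of its conditional table have a dual family, so suitable functions of the child
act, inside expectations, as indicators of the values of `l` (`IsDiscreteLSM.exists_test`). Both
rules test tensors against such functions.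

Rule 1, by contraposition: if two of the three variables share the parent `l`, summing over the
values of `l` writes the tensor with `r` rank-one terms. Testing the pair yields the diagonal matrix
of the positive numbers `P(l = b)`, so fewer terms are impossible
(`IsDiscreteLSM.tensorRank_three`).

Rule 2, by contradiction: if the triple has no common parent, the parent of `i` has an observed
child `s` outside the triple. Testing `i` and `s` makes the four-way tensor block diagonal, with one
nonzero block per value of the parent. As the rank is only `r`, every block has rank one, that is,
`j ⊥ k` given the parent of `i` (`IsDiscreteLSM.condIndep_of_ex_eq_sum`). The same holds with `i`,
`j`, `k` permuted.

Faithfulness makes these three relations consequences of the graph. Markov distributions in which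
part of the graph copies one fair coin (`not_entails_of_reach_avoiding`) then show that the parents
are distinct and that no two of the three variables have a common ancestor. Disjoint ancestral sets
are independent (`IsMarkov.ex_mul_of_ancestral`), so the three-way tensor has rank one, which was
excluded. -/

noncomputable section

namespace DiscreteLSM

/-! ### Expectations -/

section Expectation

variable {V : Type*} {c : V → ℕ}

open Classical in
/-- The indicator function of the event that all elements of `S` have the property `p`. -/
def allInd (S : Set V) (p : V → Prop) : ℝ := if ∀ u ∈ S, p u then 1 else 0

theorem allInd_eq_one {S : Set V} {p : V → Prop} (h : ∀ u ∈ S, p u) : allInd S p = 1 :=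
  if_pos h

theorem allInd_eq_zero {S : Set V} {p : V → Prop} (h : ¬ ∀ u ∈ S, p u) : allInd S p = 0 :=
  if_neg h

theorem allInd_congr {S : Set V} {p q : V → Prop} (h : ∀ u ∈ S, (p u ↔ q u)) :
    allInd S p = allInd S q := by
  unfold allInd
  rw [forall₂_congr h]

theorem allInd_union (S T : Set V) (p : V → Prop) :
    allInd (S ∪ T) p = allInd S p * allInd T p := by
  by_cases h1 : ∀ u ∈ S, p u
  · by_cases h2 : ∀ u ∈ T, p u
    · rw [allInd_eq_one h1, allInd_eq_one h2, one_mul]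
      exact allInd_eq_one fun u hu => hu.elim (h1 u) (h2 u)
    · rw [allInd_eq_zero h2, mul_zero]
      exact allInd_eq_zero fun h => h2 fun u hu => h u (Or.inr hu)
  · rw [allInd_eq_zero h1, zero_mul]
    exact allInd_eq_zero fun h => h1 fun u hu => h u (Or.inl hu)

theorem allInd_nonneg (S : Set V) (p : V → Prop) : 0 ≤ allInd S p := by
  unfold allInd
  split_ifs <;> norm_num

/-- The indicator function of the event that the variable `v` takes the value `a`. -/
def ind (v : V) (a : Fin (c v)) (y : Config c) : ℝ := if y v = a then 1 else 0

theorem dependsOn_ind (v : V) (a : Fin (c v)) : DependsOn (ind (c := c) v a) {v} := by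
  intro x y h
  simp [ind, h v rfl]

theorem dependsOn_mul {f g : Config c → ℝ} {S : Set V} (hf : DependsOn f S)
    (hg : DependsOn g S) : DependsOn (fun y => f y * g y) S := by
  intro x y h
  simp only [hf h, hg h]

theorem dependsOn_subset {β : Type*} {f : Config c → β} {S T : Set V} (hf : DependsOn f S)
    (h : S ⊆ T) : DependsOn f T :=
  fun _ _ hxy => hf fun u hu => hxy u (h hu)

theorem dependsOn_comp_apply {β : Type*} (v : V) (f : Fin (c v) → β) :
    DependsOn (fun y : Config c => f (y v)) {v} := by
  intro x y h
  simp [h v rfl]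

theorem allInd_singleton_eq_ind (v : V) (x y : Config c) :
    allInd {v} (fun u => y u = x u) = ind v (x v) y := by
  simp [allInd, ind]

theorem ind_mul_ind (v : V) (b b' : Fin (c v)) (y : Config c) :
    ind v b y * ind v b' y = if b = b' then ind v b y else 0 := by
  by_cases hb : b = b'
  · subst hb
    simp [ind]
  · rw [if_neg hb]
    unfold ind
    split_ifs with h1 h2
    · exact (hb (h1.symm.trans h2)).elim
    all_goals simp

theorem dependsOn_compl {β : Type*} {v w : V} (hvw : v ≠ w) {f : Fin (c v) → β} :
    DependsOn (fun y : Config c => f (y v)) {w}ᶜ :=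
  dependsOn_subset (dependsOn_comp_apply v f) (by simpa using hvw.symm)

theorem dependsOn_ind_compl {v w : V} (hvw : v ≠ w) (b : Fin (c v)) :
    DependsOn (ind (c := c) v b) {w}ᶜ :=
  dependsOn_subset (dependsOn_ind v b) (by simpa using hvw.symm)

theorem ind_sum_update [DecidableEq V] (v : V) (f : Config c → ℝ) (y : Config c) :
    f y = ∑ a, ind v a y * f (Function.update y v a) := by
  simp [ind]

variable [Fintype V] [DecidableEq V]

/-- The expectation of a real function of all variables. -/
def JointDist.ex (P : JointDist c) (f : Config c → ℝ) : ℝ := ∑ y, P.prob y * f y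

/-- The conditional probability that `v` takes the value `a` given the values of `y` on `S`. -/
def JointDist.cp (P : JointDist c) (v : V) (S : Set V) (a : Fin (c v)) (y : Config c) : ℝ :=
  P.marg (insert v S) (Function.update y v a) / P.marg S y

theorem JointDist.ex_sum (P : JointDist c) {ι : Type*} (s : Finset ι) (f : ι → Config c → ℝ) :
    P.ex (fun y => ∑ t ∈ s, f t y) = ∑ t ∈ s, P.ex (f t) := by
  simp only [JointDist.ex, Finset.mul_sum]
  exact Finset.sum_comm

theorem JointDist.ex_const_mul (P : JointDist c) (r : ℝ) (f : Config c → ℝ) :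
    P.ex (fun y => r * f y) = r * P.ex f := by
  simp only [JointDist.ex, Finset.mul_sum]
  exact Finset.sum_congr rfl fun y _ => by ring

theorem JointDist.ex_one (P : JointDist c) : P.ex (fun _ => 1) = 1 := by
  simp [JointDist.ex, P.sum_eq_one]

theorem JointDist.nonempty_config (P : JointDist c) : Nonempty (Config c) := by
  by_contra hne
  rw [not_nonempty_iff] at hne
  simpa using P.sum_eq_one

theorem JointDist.pr_eq_ex (P : JointDist c) (E : Set (Config c)) :
    P.pr E = P.ex (E.indicator 1) := by
  refine Finset.sum_congr rfl fun y _ => ?_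
  by_cases h : y ∈ E <;> simp [h]

theorem JointDist.marg_eq_ex (P : JointDist c) (S : Set V) (x : Config c) :
    P.marg S x = P.ex fun y => allInd S fun v => y v = x v := by
  rw [JointDist.marg, JointDist.pr_eq_ex]
  refine Finset.sum_congr rfl fun y _ => ?_
  beta_reduce
  congr 1

theorem JointDist.marg_dependsOn (P : JointDist c) (S : Set V) : DependsOn (P.marg S) S := by
  intro x y h
  simp only [JointDist.marg_eq_ex]
  congr 1
  funext z
  exact allInd_congr fun u hu => by rw [h u hu]

theorem JointDist.ex_mono (P : JointDist c) {f g : Config c → ℝ} (h : ∀ y, f y ≤ g y) :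
    P.ex f ≤ P.ex g :=
  Finset.sum_le_sum fun y _ => mul_le_mul_of_nonneg_left (h y) (P.nonneg y)

theorem JointDist.marg_nonneg (P : JointDist c) (S : Set V) (x : Config c) : 0 ≤ P.marg S x := by
  rw [JointDist.marg_eq_ex]
  exact Finset.sum_nonneg fun y _ => mul_nonneg (P.nonneg y) (allInd_nonneg _ _)

theorem JointDist.marg_anti (P : JointDist c) {S T : Set V} (h : S ⊆ T) (x : Config c) :
    P.marg T x ≤ P.marg S x := by
  simp only [JointDist.marg_eq_ex]
  refine P.ex_mono fun y => ?_
  by_cases h1 : ∀ v ∈ T, y v = x v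
  · rw [allInd_eq_one h1, allInd_eq_one fun v hv => h1 v (h hv)]
  · rw [allInd_eq_zero h1]
    exact allInd_nonneg _ _

theorem JointDist.cp_dependsOn (P : JointDist c) (v : V) (S : Set V) (a : Fin (c v)) :
    DependsOn (P.cp v S a) S := by
  intro x y h
  unfold JointDist.cp
  rw [P.marg_dependsOn S h]
  congr 1
  refine P.marg_dependsOn _ fun u hu => ?_
  by_cases huv : u = v
  · subst huv; simp
  · simp [huv, h u (hu.resolve_left huv)]

theorem sum_eq_sum_of_fiberwise (N : Set V) {F F' : Config c → ℝ}
    (h : ∀ y₀ : Config c, ∑ y, allInd N (fun u => y u = y₀ u) * F y =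
      ∑ y, allInd N (fun u => y u = y₀ u) * F' y) :
    ∑ y, F y = ∑ y, F' y := by
  classical
  have key : ∀ F : Config c → ℝ, ∑ η : (∀ u : N, Fin (c u)),
      ∑ y with (fun u : N => y u) = η, F y = ∑ y, F y := fun F =>
    Finset.sum_fiberwise Finset.univ (fun (y : Config c) (u : N) => y u) F
  rw [← key F, ← key F']
  refine Finset.sum_congr rfl fun η _ => ?_
  by_cases hη : ∃ y₀ : Config c, (fun u : N => y₀ u) = η
  · obtain ⟨y₀, rfl⟩ := hη
    have e : ∀ F : Config c → ℝ, ∑ y with (fun u : N => y u) = fun u : N => y₀ u, F y =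
        ∑ y, allInd N (fun u => y u = y₀ u) * F y := by
      intro F
      rw [Finset.sum_filter]
      refine Finset.sum_congr rfl fun y _ => ?_
      by_cases hy : ∀ u ∈ N, y u = y₀ u
      · rw [if_pos (funext fun u : N => hy u u.2), allInd_eq_one hy, one_mul]
      · rw [if_neg fun h' => hy fun u hu => congrFun h' ⟨u, hu⟩, allInd_eq_zero hy, zero_mul]
    rw [e, e, h]
  · have : ∀ y : Config c, ¬ (fun u : N => y u) = η := fun y hy => hη ⟨y, hy⟩
    simp [this]

/-- If `v` is independent of the variables in `N` given those in `S ⊆ N`, then the indicator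
function of a value of `v` may be replaced by its conditional probability given `S` when it is
integrated against a function of the variables in `N`. -/
theorem JointDist.CondIndep.ex_ind_mul {P : JointDist c} {v : V} {N S : Set V}
    (h : P.CondIndep {v} N S) (hS : S ⊆ N) (hv : v ∉ N) (a : Fin (c v)) {g : Config c → ℝ}
    (hg : DependsOn g N) :
    P.ex (fun y => ind v a y * g y) = P.ex (fun y => P.cp v S a y * g y) := by
  refine sum_eq_sum_of_fiberwise N fun y₀ => ?_
  have h1 : ∑ y, allInd N (fun u => y u = y₀ u) * (P.prob y * (ind v a y * g y)) =
      g y₀ * P.marg (insert v N) (Function.update y₀ v a) := by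
    rw [JointDist.marg_eq_ex, JointDist.ex, Finset.mul_sum]
    refine Finset.sum_congr rfl fun y _ => ?_
    rw [Set.insert_eq, allInd_union]
    rw [allInd_congr (S := N) (p := fun u => y u = Function.update y₀ v a u)
      (q := fun u => y u = y₀ u)
      fun u hu => by rw [Function.update_of_ne (ne_of_mem_of_not_mem hu hv)]]
    have e : allInd {v} (fun u => y u = Function.update y₀ v a u) = ind v a y := by
      unfold allInd ind
      simp
    rw [e]
    by_cases hy : ∀ u ∈ N, y u = y₀ u
    · rw [hg hy]
      ring
    · rw [allInd_eq_zero hy]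
      ring
  have h2 : ∑ y, allInd N (fun u => y u = y₀ u) * (P.prob y * (P.cp v S a y * g y)) =
      g y₀ * (P.cp v S a y₀ * P.marg N y₀) := by
    rw [JointDist.marg_eq_ex, JointDist.ex, Finset.mul_sum, Finset.mul_sum]
    refine Finset.sum_congr rfl fun y _ => ?_
    by_cases hy : ∀ u ∈ N, y u = y₀ u
    · rw [hg hy, P.cp_dependsOn v S a fun u hu => hy u (hS hu)]
      ring
    · rw [allInd_eq_zero hy]
      ring
  rw [h1, h2]
  congr 1
  have h3 := h (Function.update y₀ v a)
  have e1 : ({v} : Set V) ∪ N ∪ S = insert v N := by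
    rw [Set.union_assoc, Set.union_eq_left.2 hS, Set.singleton_union]
  rw [e1, Set.union_eq_left.2 hS, Set.singleton_union] at h3
  have e2 : ∀ T ⊆ N, P.marg T (Function.update y₀ v a) = P.marg T y₀ := fun T hT =>
    P.marg_dependsOn T fun u hu => Function.update_of_ne (ne_of_mem_of_not_mem (hT hu) hv) _ _
  rw [e2 S hS, e2 N subset_rfl] at h3
  unfold JointDist.cp
  -- Joint states may have probability zero. There `cp` takes the default value `0`, which is
  -- harmless because the larger marginal vanishes too.
  by_cases h0 : P.marg S y₀ = 0
  · rw [h0, div_zero, zero_mul]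
    refine le_antisymm ?_ (P.marg_nonneg _ _)
    rw [← h0, ← e2 S hS]
    exact P.marg_anti (hS.trans (Set.subset_insert _ _)) _
  · field_simp
    linarith

end Expectation

/-! ### Disjoint ancestral sets -/

section Ancestral

variable {V : Type*} {G : Digraph V}

theorem Acyclic.eq_of_reach (hG : Acyclic G) {u v : V} (h : Relation.ReflTransGen G.Adj u v)
    (h' : Relation.ReflTransGen G.Adj v u) : u = v := by
  rcases Relation.reflTransGen_iff_eq_or_transGen.1 h with h1 | h1
  · exact h1.symm
  · exact (hG u (h1.trans_left h')).elim

theorem Acyclic.exists_sink [Finite V] (hG : Acyclic G) {A : Set V} (hA : A.Nonempty) :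
    ∃ v ∈ A, ∀ w ∈ A, Relation.ReflTransGen G.Adj v w → w = v := by
  let R : V → V → Prop := fun a b => Relation.TransGen G.Adj b a
  have : IsTrans V R := ⟨fun a b d h h' => h'.trans h⟩
  have : Std.Irrefl R := ⟨fun a h => hG a h⟩
  have wf : WellFounded R := Finite.wellFounded_of_trans_of_irrefl R
  obtain ⟨v, hv, hmin⟩ := wf.has_min A hA
  refine ⟨v, hv, fun w hw h => ?_⟩
  rcases Relation.reflTransGen_iff_eq_or_transGen.1 h with h1 | h1
  · exact h1
  · exact (hmin w hw h1).elim

variable [Fintype V] [DecidableEq V] {c : V → ℕ} {P : JointDist c}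

theorem IsMarkov.ex_ind_mul (hG : Acyclic G) (hP : IsMarkov G P) (v : V) (a : Fin (c v))
    {g : Config c → ℝ} (hg : DependsOn g (descendants G v)ᶜ) :
    P.ex (fun y => ind v a y * g y) = P.ex (fun y => P.cp v (parents G v) a y * g y) := by
  refine (hP v).ex_ind_mul (fun u hu hd => ?_) (fun h => h Relation.ReflTransGen.refl) a hg
  exact hG u (Relation.TransGen.head' hu hd)

/-- Integrates out a sink `v` of `A`: `f'` averages `f` over `v` with weights `P(v = a | parents)`.
This is invisible to functions of non-descendants and removes one variable from the support. -/
theorem IsMarkov.exists_strip (hG : Acyclic G) (hP : IsMarkov G P) {A : Set V} {v : V}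
    (hpa : parents G v ⊆ A \ {v}) (hA : A \ {v} ⊆ (descendants G v)ᶜ)
    {f : Config c → ℝ} (hf : DependsOn f A) :
    ∃ f', DependsOn f' (A \ {v}) ∧ ∀ g, DependsOn g (descendants G v)ᶜ →
      P.ex (fun y => f y * g y) = P.ex (fun y => f' y * g y) := by
  have hfa : ∀ a : Fin (c v), DependsOn (fun y => f (Function.update y v a)) (A \ {v}) := by
    intro a x y h
    refine hf fun u hu => ?_
    by_cases huv : u = v
    · subst huv; simp
    · simp [huv, h u ⟨hu, huv⟩]
  refine ⟨fun y => ∑ a, P.cp v (parents G v) a y * f (Function.update y v a), ?_, fun g hg => ?_⟩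
  · intro x y h
    refine Finset.sum_congr rfl fun a _ => ?_
    rw [P.cp_dependsOn v _ a fun u hu => h u (hpa hu)]
    congr 1
    exact hfa a h
  · have e : (fun y => f y * g y) =
        fun y => ∑ a, ind v a y * (f (Function.update y v a) * g y) := by
      funext y
      conv_lhs => rw [ind_sum_update v f y]
      rw [Finset.sum_mul]
      exact Finset.sum_congr rfl fun a _ => by ring
    rw [e, P.ex_sum]
    simp only [Finset.sum_mul, P.ex_sum]
    refine Finset.sum_congr rfl fun a _ => ?_
    rw [IsMarkov.ex_ind_mul hG hP v a (dependsOn_mul (dependsOn_subset (hfa a) hA) hg)]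
    congr 1
    funext y
    ring

/-- Functions of two disjoint ancestral sets of variables are uncorrelated. -/
theorem IsMarkov.ex_mul_of_ancestral (hG : Acyclic G) (hP : IsMarkov G P) {A B : Set V}
    (hA : ∀ u v, G.Adj u v → v ∈ A → u ∈ A) (hB : ∀ u v, G.Adj u v → v ∈ B → u ∈ B)
    (hAB : Disjoint A B) {f g : Config c → ℝ} (hf : DependsOn f A) (hg : DependsOn g B) :
    P.ex (fun y => f y * g y) = P.ex f * P.ex g := by
  induction hn : A.ncard generalizing A f with
  | zero =>
    rw [Set.ncard_eq_zero] at hn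
    subst hn
    have hc : ∀ x y, f x = f y := fun x y => hf fun u hu => hu.elim
    obtain ⟨y₀⟩ := P.nonempty_config
    have e : f = fun _ => f y₀ * 1 := by funext y; rw [hc y y₀, mul_one]
    have h1 : P.ex f = f y₀ := by
      rw [e, P.ex_const_mul, P.ex_one, mul_one]
    rw [h1, ← P.ex_const_mul]
    simp only [hc _ y₀]
  | succ n ih =>
    have hne : A.Nonempty := by
      rw [← Set.ncard_pos, hn]
      exact n.succ_pos
    obtain ⟨v, hv, hsink⟩ := hG.exists_sink hne
    have hadj : ∀ w, G.Adj v w → w ∉ A := fun w hw hwA =>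
      hG v (by
        have := hsink w hwA (Relation.ReflTransGen.single hw)
        subst this
        exact Relation.TransGen.single hw)
    -- A descendant of `v` in the ancestral set `B` would pull `v` itself into `B`.
    have hBd : B ⊆ (descendants G v)ᶜ := by
      intro w hw hd
      have hvB : v ∈ B := by
        change Relation.ReflTransGen G.Adj v w at hd
        induction hd with
        | refl => exact hw
        | tail _ h2 ih2 => exact ih2 (hB _ _ h2 hw)
      exact Set.disjoint_left.1 hAB hv hvB
    obtain ⟨f', hf', h⟩ := IsMarkov.exists_strip (P := P) hG hP (A := A) (v := v)
      (fun u hu => ⟨hA u v hu hv, fun e =>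
        hadj v (by rw [Set.mem_singleton_iff] at e; subst e; exact hu) hv⟩)
      (fun w hw hd => hw.2 (hsink w hw.1 hd)) hf
    have h1 : P.ex f = P.ex f' := by
      have := h (fun _ => 1) (fun _ _ _ => rfl)
      simpa using this
    rw [h g (dependsOn_subset hg hBd), h1]
    refine ih ?_ (hAB.mono_left Set.sdiff_subset) hf' ?_
    · rintro u w hu ⟨hw, hwv⟩
      refine ⟨hA u w hu hw, fun e => ?_⟩
      rw [Set.mem_singleton_iff] at e
      subst e
      exact hadj w hu hw
    · rw [Set.ncard_sdiff_singleton_of_mem hv, hn]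
      rfl

end Ancestral

/-! ### Relations that are not entailed by the causal Markov condition -/

section NotEntailed

variable {V : Type*} {G : Digraph V}

/-- The restricted relation forbids only arriving at `w`; the starting vertex is unconstrained. This
is why `t ≠ w` is demanded separately later. -/
theorem reach_avoiding_or {t v : V} (w : V) (h : Relation.ReflTransGen G.Adj t v) :
    Relation.ReflTransGen (fun u v => G.Adj u v ∧ v ≠ w) t v ∨
      (Relation.ReflTransGen G.Adj t w ∧ Relation.ReflTransGen G.Adj w v) := by
  induction h with
  | refl => exact Or.inl .refl
  | @tail u v h1 h2 ih =>
    rcases ih with ih | ⟨ih, ih'⟩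
    · by_cases hv : v = w
      · subst hv
        exact Or.inr ⟨h1.tail h2, .refl⟩
      · exact Or.inl (ih.tail ⟨h2, hv⟩)
    · exact Or.inr ⟨ih, ih'.tail h2⟩

open Classical in
/-- The configuration in which the variables in `D` have the value `1` and all others `0`. -/
def oneOn (D : Set V) : Config (fun _ : V => 2) := fun u => if u ∈ D then 1 else 0

theorem oneOn_of_mem {D : Set V} {u : V} (h : u ∈ D) : oneOn D u = 1 := if_pos h

theorem oneOn_of_notMem {D : Set V} {u : V} (h : u ∉ D) : oneOn D u = 0 := if_neg h

variable [Fintype V] [DecidableEq V]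

/-- The distribution in which the variables in `D` are copies of one fair coin and all others are
constant. -/
def copyDist (D : Set V) : JointDist (fun _ : V => 2) where
  prob y := (if y = 0 then 1 / 2 else 0) + (if y = oneOn D then 1 / 2 else 0)
  nonneg y := by positivity
  sum_eq_one := by
    rw [Finset.sum_add_distrib, Finset.sum_ite_eq', Finset.sum_ite_eq']
    norm_num

theorem marg_copyDist (D S : Set V) (x : Config (fun _ : V => 2)) :
    (copyDist D).marg S x =
      (allInd S (fun u => x u = 0) + allInd S (fun u => x u = oneOn D u)) / 2 := by
  have e : ∀ z : Config (fun _ : V => 2),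
      (∑ y : Config (fun _ : V => 2), (if y = z then (1 / 2 : ℝ) else 0) *
        allInd S (fun u => y u = x u)) = allInd S (fun u => x u = z u) / 2 := by
    intro z
    rw [Finset.sum_eq_single z]
    · rw [if_pos rfl, allInd_congr fun u _ => eq_comm]
      ring
    · intro y _ hy
      simp [hy]
    · simp
  rw [JointDist.marg_eq_ex, add_div]
  refine Eq.trans ?_ (congrArg₂ (· + ·) (e 0) (e (oneOn D)))
  rw [← Finset.sum_add_distrib]
  refine Finset.sum_congr rfl fun y _ => ?_
  rw [← add_mul]
  rfl

/-- A vertex outside `D` is constant. The root `t` has only constant non-descendants. Any other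
vertex of `D` has a parent in `D`, which reveals the coin and so makes everything deterministic. -/
theorem isMarkov_copyDist {D : Set V} {t : V} (hdesc : D ⊆ descendants G t)
    (hpar : ∀ v ∈ D, v ≠ t → ∃ u ∈ D, G.Adj u v) : IsMarkov G (copyDist D) := by
  intro v x
  simp only [marg_copyDist, allInd_union]
  -- For a mixture of two point masses, the defect of conditional independence is `1/4` of this
  -- product.
  have key : allInd (parents G v) (fun u => x u = 0) *
      allInd (parents G v) (fun u => x u = oneOn D u) *
      (allInd {v} (fun u => x u = 0) - allInd {v} (fun u => x u = oneOn D u)) *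
      (allInd (descendants G v)ᶜ (fun u => x u = 0) -
        allInd (descendants G v)ᶜ (fun u => x u = oneOn D u)) = 0 := by
    by_cases hvD : v ∈ D
    · by_cases hvt : v = t
      · rw [allInd_congr (S := (descendants G v)ᶜ) (p := fun u => x u = 0)
          (q := fun u => x u = oneOn D u), sub_self, mul_zero]
        intro u hu
        rw [oneOn_of_notMem fun huD => hu (hvt ▸ hdesc huD)]
      · obtain ⟨u, huD, huv⟩ := hpar v hvD hvt
        by_cases hx : x u = 0
        · rw [allInd_eq_zero (S := parents G v) (p := fun u => x u = oneOn D u)]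
          · ring
          · intro h
            have := h u huv
            rw [hx, oneOn_of_mem huD] at this
            exact zero_ne_one this
        · rw [allInd_eq_zero (S := parents G v) (p := fun u => x u = 0) fun h => hx (h u huv)]
          ring
    · rw [allInd_congr (S := {v}) (p := fun u => x u = 0) (q := fun u => x u = oneOn D u)]
      · ring
      · rintro u rfl
        rw [oneOn_of_notMem hvD]
  generalize allInd (parents G v) (fun u => x u = 0) = p at *
  generalize allInd (parents G v) (fun u => x u = oneOn D u) = q at *
  generalize allInd {v} (fun u => x u = 0) = a at *
  generalize allInd {v} (fun u => x u = oneOn D u) = b at *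
  generalize allInd (descendants G v)ᶜ (fun u => x u = 0) = d at *
  generalize allInd (descendants G v)ᶜ (fun u => x u = oneOn D u) = e at *
  linear_combination (1 / 4) * key

theorem not_entails_of_copies {D : Set V} {t a b w : V} (hdesc : D ⊆ descendants G t)
    (hpar : ∀ v ∈ D, v ≠ t → ∃ u ∈ D, G.Adj u v) (ha : a ∈ D) (hb : b ∈ D) (hw : w ∉ D) :
    ¬ Entails G {a} {b} {w} := by
  intro h
  -- At the zero configuration `w` carries no information, and independence would read `1/2 = 1/2 *
  -- 1/2`.
  have := h _ _ (isMarkov_copyDist hdesc hpar) 0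
  simp only [marg_copyDist, allInd_union] at this
  norm_num [ha, hb, hw, allInd, oneOn] at this

theorem not_entails_of_reach_avoiding {t a b w : V} (htw : t ≠ w)
    (ha : Relation.ReflTransGen (fun u v => G.Adj u v ∧ v ≠ w) t a)
    (hb : Relation.ReflTransGen (fun u v => G.Adj u v ∧ v ≠ w) t b) :
    ¬ Entails G {a} {b} {w} := by
  refine not_entails_of_copies
    (D := {v | Relation.ReflTransGen (fun u v => G.Adj u v ∧ v ≠ w) t v}) (t := t)
    (fun v hv => Relation.ReflTransGen.mono (fun _ _ h => h.1) _ _ hv) (fun v hv hvt => ?_) ha hb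
    fun hw => ?_
  · rcases Relation.ReflTransGen.cases_tail hv with h | ⟨u, hu, huv⟩
    · exact (hvt h).elim
    · exact ⟨u, hu, huv.1⟩
  · rcases Relation.ReflTransGen.cases_tail hw with h | ⟨u, hu, huv⟩
    · exact htw h.symm
    · exact huv.2 rfl

end NotEntailed

/-! ### Linear algebra -/

section LinearAlgebra

theorem exists_relation_of_lt_card {ι : Type*} [Fintype ι] {R : ℕ} (h : R < Fintype.card ι)
    (U : ι → Fin R → ℝ) : ∃ g : ι → ℝ, g ≠ 0 ∧ ∀ t, ∑ s, g s * U s t = 0 := by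
  have hU : ¬ LinearIndependent ℝ U := by
    intro hU
    have := hU.fintype_card_le_finrank
    rw [Module.finrank_fin_fun] at this
    omega
  obtain ⟨g, hg, s, hs⟩ := Fintype.not_linearIndependent_iff.1 hU
  refine ⟨g, fun h0 => hs (congrFun h0 s), fun t => ?_⟩
  simpa using congrFun hg t

theorem exists_dual_of_linearIndependent {n m : ℕ} {w : Fin n → Fin m → ℝ}
    (h : LinearIndependent ℝ w) :
    ∃ B : Fin n → Fin m → ℝ, ∀ l l', ∑ a, B l a * w l' a = if l' = l then 1 else 0 := by
  -- The dual family consists of the coordinates of a left inverse of the map from coefficients to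
  -- combinations.
  obtain ⟨g, hg⟩ := (Fintype.linearCombination ℝ w).exists_leftInverse_of_injective
    (LinearMap.ker_eq_bot.2 (linearIndependent_iff_injective_fintypeLinearCombination.1 h))
  refine ⟨fun l a => g (Pi.single a 1) l, fun l l' => ?_⟩
  have h1 := congrFun (LinearMap.congr_fun hg (Pi.single l' 1)) l
  rw [LinearMap.comp_apply, Fintype.linearCombination_apply_single, one_smul,
    LinearMap.id_apply, LinearMap.pi_apply_eq_sum_univ g (w l'), Finset.sum_apply] at h1
  simp only [Pi.smul_apply, smul_eq_mul] at h1
  rw [Pi.single_apply] at h1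
  have e : ∀ a : Fin m, (fun j => if a = j then (1 : ℝ) else 0) = Pi.single a 1 := by
    intro a
    funext j
    rw [Pi.single_apply]
    exact if_congr eq_comm rfl rfl
  simp only [e] at h1
  rw [if_congr (eq_comm (a := l') (b := l)) rfl rfl, ← h1]
  exact Finset.sum_congr rfl fun a _ => mul_comm _ _

end LinearAlgebra

/-! ### Probability tensors -/

section Tensor

variable {V : Type*} [Fintype V] [DecidableEq V] {c : V → ℕ}

theorem JointDist.tensor_eq_ex (P : JointDist c) {n : ℕ} (v : Fin n → V)
    (a : ∀ m, Fin (c (v m))) : P.tensor v a = P.ex fun y => ∏ m, ind (v m) (a m) y := by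
  rw [JointDist.tensor, JointDist.pr_eq_ex]
  congr 1
  funext y
  by_cases h : ∀ m, y (v m) = a m
  · rw [Set.indicator_of_mem (s := {y : Config c | ∀ m, y (v m) = a m}) h]
    simp [ind, h]
  · rw [Set.indicator_of_notMem (s := {y : Config c | ∀ m, y (v m) = a m}) h]
    obtain ⟨m, hm⟩ := not_forall.1 h
    exact (Finset.prod_eq_zero (Finset.mem_univ m) (if_neg hm)).symm

theorem JointDist.ex_prod_eq_sum (P : JointDist c) {n : ℕ} {v : Fin n → V} {R : ℕ}
    {u : Fin R → ∀ m, Fin (c (v m)) → ℝ} (h : P.tensor v = ∑ t, outerProduct (u t))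
    (f : ∀ m, Fin (c (v m)) → ℝ) :
    P.ex (fun y => ∏ m, f m (y (v m))) = ∑ t, ∏ m, ∑ a, u t m a * f m a := by
  have e : (fun y : Config c => ∏ m, f m (y (v m))) =
      fun y => ∑ a : ∀ m, Fin (c (v m)), (∏ m, f m (a m)) * ∏ m, ind (v m) (a m) y := by
    funext y
    rw [Finset.sum_eq_single fun m => y (v m)]
    · simp [ind]
    · intro a _ ha
      obtain ⟨m, hm⟩ := Function.ne_iff.1 ha
      rw [Finset.prod_eq_zero (f := fun m => ind (v m) (a m) y) (Finset.mem_univ m), mul_zero]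
      exact if_neg fun h' => hm h'.symm
    · simp
  rw [e, P.ex_sum]
  simp only [P.ex_const_mul, ← P.tensor_eq_ex, h, Finset.sum_apply, Finset.mul_sum]
  rw [Finset.sum_comm]
  refine Finset.sum_congr rfl fun t _ => ?_
  rw [Finset.prod_univ_sum, Fintype.piFinset_univ]
  refine Finset.sum_congr rfl fun a _ => ?_
  rw [outerProduct, Finset.prod_mul_distrib, mul_comm]

/-- Linearity of the functionals is not recorded: only their values at test functions enter the rank
arguments. -/
theorem JointDist.exists_ex_eq_sum_three (P : JointDist c) {v₀ v₁ v₂ : V} {R : ℕ}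
    (h : ∃ u : Fin R → ∀ m, Fin (c (![v₀, v₁, v₂] m)) → ℝ,
      P.tensor ![v₀, v₁, v₂] = ∑ t, outerProduct (u t)) :
    ∃ (A₀ : Fin R → (Fin (c v₀) → ℝ) → ℝ) (A₁ : Fin R → (Fin (c v₁) → ℝ) → ℝ)
      (A₂ : Fin R → (Fin (c v₂) → ℝ) → ℝ), ∀ f₀ f₁ f₂,
      P.ex (fun y => f₀ (y v₀) * f₁ (y v₁) * f₂ (y v₂)) =
        ∑ t, A₀ t f₀ * A₁ t f₁ * A₂ t f₂ := by
  obtain ⟨u, hu⟩ := h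
  refine ⟨fun t f => ∑ a, u t 0 a * f a, fun t f => ∑ a, u t 1 a * f a,
    fun t f => ∑ a, u t 2 a * f a, fun f₀ f₁ f₂ => ?_⟩
  have := P.ex_prod_eq_sum hu (fun m => match m with
    | 0 => f₀
    | 1 => f₁
    | 2 => f₂)
  simp only [Fin.prod_univ_three] at this
  exact this

theorem JointDist.exists_ex_eq_sum_four (P : JointDist c) {v₀ v₁ v₂ v₃ : V} {R : ℕ}
    (h : ∃ u : Fin R → ∀ m, Fin (c (![v₀, v₁, v₂, v₃] m)) → ℝ,
      P.tensor ![v₀, v₁, v₂, v₃] = ∑ t, outerProduct (u t)) :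
    ∃ (A₀ : Fin R → (Fin (c v₀) → ℝ) → ℝ) (A₁ : Fin R → (Fin (c v₁) → ℝ) → ℝ)
      (A₂ : Fin R → (Fin (c v₂) → ℝ) → ℝ) (A₃ : Fin R → (Fin (c v₃) → ℝ) → ℝ),
      ∀ f₀ f₁ f₂ f₃,
      P.ex (fun y => f₀ (y v₀) * f₁ (y v₁) * f₂ (y v₂) * f₃ (y v₃)) =
        ∑ t, A₀ t f₀ * A₁ t f₁ * A₂ t f₂ * A₃ t f₃ := by
  obtain ⟨u, hu⟩ := h
  refine ⟨fun t f => ∑ a, u t 0 a * f a, fun t f => ∑ a, u t 1 a * f a,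
    fun t f => ∑ a, u t 2 a * f a, fun t f => ∑ a, u t 3 a * f a, fun f₀ f₁ f₂ f₃ => ?_⟩
  have := P.ex_prod_eq_sum hu (fun m => match m with
    | 0 => f₀
    | 1 => f₁
    | 2 => f₂
    | 3 => f₃)
  simp only [Fin.prod_univ_four] at this
  exact this

theorem exists_eq_sum_of_tensorRank_eq {n : ℕ} {d : Fin n → ℕ} {T : (∀ m, Fin (d m)) → ℝ} {r : ℕ}
    (h : tensorRank T = r) (hr : r ≠ 0) :
    ∃ u : Fin r → ∀ m, Fin (d m) → ℝ, T = ∑ t, outerProduct (u t) := by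
  subst h
  -- An infimum over the empty set would be `0`, which `hr` excludes.
  have hne : {R : ℕ | ∃ u : Fin R → ∀ m, Fin (d m) → ℝ, T = ∑ t, outerProduct (u t)}.Nonempty :=
    Nat.nonempty_of_sInf_eq_succ (Nat.succ_pred_eq_of_ne_zero hr).symm
  exact Nat.sInf_mem hne

theorem JointDist.tensorRank_three_eq (P : JointDist c) {v₀ v₁ v₂ : V} {r : ℕ}
    (hle : ∃ (B₀ : Fin r → Fin (c v₀) → ℝ) (B₁ : Fin r → Fin (c v₁) → ℝ)
      (B₂ : Fin r → Fin (c v₂) → ℝ), ∀ a b d,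
      P.ex (fun y => ind v₀ a y * ind v₁ b y * ind v₂ d y) = ∑ t, B₀ t a * B₁ t b * B₂ t d)
    (hge : ∀ (R : ℕ) (A₀ : Fin R → (Fin (c v₀) → ℝ) → ℝ) (A₁ : Fin R → (Fin (c v₁) → ℝ) → ℝ)
      (A₂ : Fin R → (Fin (c v₂) → ℝ) → ℝ), (∀ f₀ f₁ f₂,
      P.ex (fun y => f₀ (y v₀) * f₁ (y v₁) * f₂ (y v₂)) =
        ∑ t, A₀ t f₀ * A₁ t f₁ * A₂ t f₂) → r ≤ R) :
    tensorRank (P.tensor ![v₀, v₁, v₂]) = r := by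
  obtain ⟨B₀, B₁, B₂, hB⟩ := hle
  have hmem : ∃ u : Fin r → ∀ m, Fin (c (![v₀, v₁, v₂] m)) → ℝ,
      P.tensor ![v₀, v₁, v₂] = ∑ t, outerProduct (u t) := by
    refine ⟨fun t m => match m with
      | 0 => B₀ t
      | 1 => B₁ t
      | 2 => B₂ t, ?_⟩
    funext a
    rw [P.tensor_eq_ex, Finset.sum_apply]
    simp only [outerProduct, Fin.prod_univ_three]
    exact hB (a 0) (a 1) (a 2)
  refine le_antisymm (Nat.sInf_le hmem) ?_
  refine le_csInf ⟨r, hmem⟩ fun R hR => ?_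
  obtain ⟨A₀, A₁, A₂, hA⟩ := P.exists_ex_eq_sum_three hR
  exact hge R A₀ A₁ A₂ hA

theorem JointDist.tensorRank_eq_one_of_indep (P : JointDist c) {n : ℕ} (v : Fin n → V)
    (h : ∀ a : ∀ m, Fin (c (v m)),
      P.ex (fun y => ∏ m, ind (v m) (a m) y) = ∏ m, P.ex (ind (v m) (a m))) :
    tensorRank (P.tensor v) = 1 := by
  have hmem : ∃ u : Fin 1 → ∀ m, Fin (c (v m)) → ℝ, P.tensor v = ∑ t, outerProduct (u t) := by
    refine ⟨fun _ m a => P.ex (ind (v m) a), ?_⟩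
    funext a
    rw [P.tensor_eq_ex, h]
    simp [outerProduct]
  refine le_antisymm (Nat.sInf_le hmem) (le_csInf ⟨1, hmem⟩ fun R hR => ?_)
  obtain ⟨u, hu⟩ := hR
  by_contra hR0
  -- The total mass is `1`, so an empty sum of rank-one terms is impossible.
  have h1 := P.ex_prod_eq_sum hu fun _ _ => 1
  obtain rfl : R = 0 := by omega
  simp [P.ex_one] at h1

end Tensor

/-! ### Observed variables with a common latent parent -/

section Model

variable {L X : Type*} [Fintype L] [DecidableEq L] [Fintype X] [DecidableEq X]
  {G : Digraph (L ⊕ X)} {c : L ⊕ X → ℕ} {P : JointDist c}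

theorem IsDiscreteLSM.parents_inr (h : IsDiscreteLSM G c P) {l : L} {x : X}
    (hl : G.Adj (Sum.inl l) (Sum.inr x)) : parents G (Sum.inr x) = {Sum.inl l} := by
  ext u
  rw [Set.mem_singleton_iff]
  constructor
  · rintro hu
    rcases u with l' | x'
    · rw [(h.pure_observed x).unique hu hl]
    · exact (h.no_edge_observed x' x hu).elim
  · rintro rfl
    exact hl

theorem IsDiscreteLSM.descendants_inr (h : IsDiscreteLSM G c P) (x : X) :
    descendants G (Sum.inr x) = {Sum.inr x} := by
  ext u
  rw [Set.mem_singleton_iff]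
  constructor
  · intro hu
    rcases Relation.ReflTransGen.cases_head hu with h1 | ⟨w, hw, -⟩
    · exact h1.symm
    · rcases w with l' | x'
      · exact (h.no_edge_to_latent x l' hw).elim
      · exact (h.no_edge_observed x x' hw).elim
  · rintro rfl
    exact Relation.ReflTransGen.refl

theorem condProb_eq_cp (v : L ⊕ X) (hv : v ∉ parents G v) (y : Config c) (a : Fin (c v)) :
    condProb G P v (fun u => y u) a = P.cp v (parents G v) a y := by
  unfold condProb JointDist.cp JointDist.marg
  congr 2
  · ext z
    simp only [Set.mem_ofPred_eq, Set.forall_mem_insert, Function.update_self, Subtype.forall]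
    refine and_congr Iff.rfl (forall₂_congr fun u hu => ?_)
    rw [Function.update_of_ne (ne_of_mem_of_not_mem hu hv)]
  · ext z
    simp only [Set.mem_ofPred_eq, Subtype.forall]

/-- The table of the conditional probabilities of an observed variable given its latent parent. -/
theorem IsDiscreteLSM.exists_table (h : IsDiscreteLSM G c P) (hP : IsMarkov G P) {l : L} {x : X}
    (hl : G.Adj (Sum.inl l) (Sum.inr x)) (hx : FullRankAt G P (Sum.inr x)) :
    ∃ w : Fin (c (Sum.inl l)) → Fin (c (Sum.inr x)) → ℝ, LinearIndependent ℝ w ∧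
      ∀ a g, DependsOn g {Sum.inr x}ᶜ → P.ex (fun y => ind (Sum.inr x) a y * g y) =
        P.ex (fun y => w (y (Sum.inl l)) a * g y) := by
  obtain ⟨y₀⟩ := P.nonempty_config
  let π : Fin (c (Sum.inl l)) → ∀ u : parents G (Sum.inr x), Fin (c u) :=
    fun b u => Function.update y₀ (Sum.inl l) b u
  have hπ : Function.Injective π := by
    intro b b' hb
    have := congrFun hb ⟨Sum.inl l, hl⟩
    simpa [π] using this
  refine ⟨fun b => condProb G P (Sum.inr x) (π b), hx.comp π hπ, fun a g hg => ?_⟩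
  rw [← h.descendants_inr x] at hg
  rw [IsMarkov.ex_ind_mul h.acyclic hP _ a hg]
  congr 1
  funext y
  rw [← condProb_eq_cp]
  · congr 2
    funext u
    obtain ⟨u, hu⟩ := u
    have hu' := hu
    rw [h.parents_inr hl, Set.mem_singleton_iff] at hu'
    subst hu'
    simp [π]
  · rw [h.parents_inr hl]
    simp

/-- By full rank, integrating a suitable function of an observed child of a latent variable amounts
to integrating the indicator function of a given value of the latent variable. -/
theorem IsDiscreteLSM.exists_test (h : IsDiscreteLSM G c P) (hP : IsMarkov G P) {l : L} {x : X}
    (hl : G.Adj (Sum.inl l) (Sum.inr x)) (hx : FullRankAt G P (Sum.inr x)) :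
    ∃ φ : Fin (c (Sum.inl l)) → Fin (c (Sum.inr x)) → ℝ, ∀ b g, DependsOn g {Sum.inr x}ᶜ →
      P.ex (fun y => φ b (y (Sum.inr x)) * g y) = P.ex (fun y => ind (Sum.inl l) b y * g y) := by
  obtain ⟨w, hw, hwP⟩ := h.exists_table hP hl hx
  obtain ⟨φ, hφ⟩ := exists_dual_of_linearIndependent hw
  refine ⟨φ, fun b g hg => ?_⟩
  have e : (fun y : Config c => φ b (y (Sum.inr x)) * g y) =
      fun y => ∑ a, φ b a * (ind (Sum.inr x) a y * g y) := by
    funext y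
    simp [ind]
  rw [e, P.ex_sum]
  simp only [P.ex_const_mul, hwP _ g hg]
  simp only [← P.ex_const_mul]
  rw [← P.ex_sum]
  congr 1
  funext y
  simp only [← mul_assoc]
  rw [← Finset.sum_mul, hφ]
  rfl

theorem IsDiscreteLSM.ex_ind_pos (h : IsDiscreteLSM G c P) (v : L ⊕ X) (b : Fin (c v)) :
    0 < P.ex (ind v b) := by
  have := h.state_pos v b
  rw [JointDist.pr_eq_ex] at this
  convert this using 2
  funext y
  by_cases hy : y v = b <;> simp [ind, hy]

/-- Dual test functions on both children turn the pair's matrix into the diagonal matrix of the `P(l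
= b)`. It is invertible and factors through dimension `R`. -/
theorem IsDiscreteLSM.card_le_of_ex_eq_sum (h : IsDiscreteLSM G c P) (hP : IsMarkov G P)
    (hF : ∀ x, FullRankAt G P (Sum.inr x)) {l : L} {i j : X} (hij : i ≠ j)
    (hi : G.Adj (Sum.inl l) (Sum.inr i)) (hj : G.Adj (Sum.inl l) (Sum.inr j)) {R : ℕ}
    {A : Fin R → (Fin (c (Sum.inr i)) → ℝ) → ℝ} {B : Fin R → (Fin (c (Sum.inr j)) → ℝ) → ℝ}
    (hAB : ∀ f g, P.ex (fun y => f (y (Sum.inr i)) * g (y (Sum.inr j))) =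
      ∑ t, A t f * B t g) : c (Sum.inl l) ≤ R := by
  obtain ⟨φ, hφ⟩ := h.exists_test hP hi (hF i)
  obtain ⟨ψ, hψ⟩ := h.exists_test hP hj (hF j)
  have key : ∀ b b', ∑ t, A t (φ b) * B t (ψ b') =
      if b = b' then P.ex (ind (Sum.inl l) b) else 0 := by
    intro b b'
    rw [← hAB, hφ b _ (dependsOn_compl (by simpa using hij.symm))]
    simp only [mul_comm (ind _ _ _)]
    rw [hψ b' _ (dependsOn_ind_compl (by simp) b)]
    simp only [mul_comm (ind _ b' _), ind_mul_ind]
    split_ifs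
    · rfl
    · simp [JointDist.ex]
  by_contra hlt
  obtain ⟨g, hg0, hg⟩ := exists_relation_of_lt_card (ι := Fin (c (Sum.inl l)))
    (by simpa using hlt) (fun b t => A t (φ b))
  refine hg0 (funext fun b' => ?_)
  have h1 : ∑ b, g b * ∑ t, A t (φ b) * B t (ψ b') = 0 := by
    simp only [Finset.mul_sum]
    rw [Finset.sum_comm]
    refine Finset.sum_eq_zero fun t _ => ?_
    simp only [← mul_assoc]
    rw [← Finset.sum_mul, hg, zero_mul]
  simp only [key, mul_ite, mul_zero, Finset.sum_ite_eq', Finset.mem_univ, if_true] at h1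
  exact (mul_eq_zero.1 h1).resolve_right (h.ex_ind_pos _ _).ne'

/-- Condition on `l`: the tables of `i` and `j` factor out, and the third factor is the joint
probability of `l` and `k`. Hence nothing is required of the parent of `k`. -/
theorem IsDiscreteLSM.exists_ex_ind_eq_sum (h : IsDiscreteLSM G c P) (hP : IsMarkov G P)
    (hF : ∀ x, FullRankAt G P (Sum.inr x)) {l : L} {i j k : X} (hij : i ≠ j) (hik : i ≠ k)
    (hjk : j ≠ k) (hi : G.Adj (Sum.inl l) (Sum.inr i)) (hj : G.Adj (Sum.inl l) (Sum.inr j)) :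
    ∃ (B₀ : Fin (c (Sum.inl l)) → Fin (c (Sum.inr i)) → ℝ)
      (B₁ : Fin (c (Sum.inl l)) → Fin (c (Sum.inr j)) → ℝ)
      (B₂ : Fin (c (Sum.inl l)) → Fin (c (Sum.inr k)) → ℝ), ∀ a b d,
      P.ex (fun y => ind (Sum.inr i) a y * ind (Sum.inr j) b y * ind (Sum.inr k) d y) =
        ∑ t, B₀ t a * B₁ t b * B₂ t d := by
  obtain ⟨w, -, hw⟩ := h.exists_table hP hi (hF i)
  obtain ⟨z, -, hz⟩ := h.exists_table hP hj (hF j)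
  refine ⟨w, z, fun t d => P.ex fun y => ind (Sum.inl l) t y * ind (Sum.inr k) d y,
    fun a b d => ?_⟩
  simp only [mul_assoc]
  rw [hw a _ (dependsOn_mul (dependsOn_ind_compl (by simpa using hij.symm) b)
    (dependsOn_ind_compl (by simpa using hik.symm) d))]
  simp only [mul_left_comm _ (ind (Sum.inr j) b _)]
  rw [hz b _ (dependsOn_mul (dependsOn_compl (f := fun t => w t a) (by simp))
    (dependsOn_ind_compl (by simpa using hjk.symm) d))]
  simp only [← P.ex_const_mul]
  rw [← P.ex_sum]
  congr 1
  funext y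
  rw [Finset.sum_eq_single (y (Sum.inl l))]
  · simp only [ind, if_true]
    ring
  · intro t _ ht
    simp [ind, ht.symm]
  · simp

/-- If `i` and `j` have a common latent parent, then the joint probability tensor of `i`, `j` and a
third observed variable has as many terms as the latent parent has values. -/
theorem IsDiscreteLSM.tensorRank_three (h : IsDiscreteLSM G c P) (hP : IsMarkov G P)
    (hF : ∀ x, FullRankAt G P (Sum.inr x)) {l : L} {i j k : X} (hij : i ≠ j) (hik : i ≠ k)
    (hjk : j ≠ k) (hi : G.Adj (Sum.inl l) (Sum.inr i)) (hj : G.Adj (Sum.inl l) (Sum.inr j)) :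
    tensorRank (P.tensor ![Sum.inr i, Sum.inr j, Sum.inr k]) = c (Sum.inl l) ∧
    tensorRank (P.tensor ![Sum.inr i, Sum.inr k, Sum.inr j]) = c (Sum.inl l) ∧
    tensorRank (P.tensor ![Sum.inr k, Sum.inr i, Sum.inr j]) = c (Sum.inl l) := by
  obtain ⟨B₀, B₁, B₂, hB⟩ := h.exists_ex_ind_eq_sum hP hF hij hik hjk hi hj
  refine ⟨P.tensorRank_three_eq ⟨B₀, B₁, B₂, hB⟩ fun R A₀ A₁ A₂ hA => ?_,
    P.tensorRank_three_eq ⟨B₀, B₂, B₁, fun a b d => ?_⟩ fun R A₀ A₂ A₁ hA => ?_,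
    P.tensorRank_three_eq ⟨B₂, B₀, B₁, fun a b d => ?_⟩ fun R A₂ A₀ A₁ hA => ?_⟩
  -- Testing `k` with the constant `1` sums it out and leaves the matrix of `i` and `j`.
  · refine h.card_le_of_ex_eq_sum hP hF hij hi hj (A := A₀)
      (B := fun t g => A₁ t g * A₂ t fun _ => 1) fun f g => ?_
    refine Eq.trans ?_ ((hA f g fun _ => 1).trans (Finset.sum_congr rfl fun t _ => by ring))
    simp only [mul_one]
  · refine Eq.trans ?_ ((hB a d b).trans (Finset.sum_congr rfl fun t _ => by ring))
    exact congrArg P.ex (funext fun y => by ring)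
  · refine h.card_le_of_ex_eq_sum hP hF hij hi hj (A := A₀)
      (B := fun t g => A₁ t g * A₂ t fun _ => 1) fun f g => ?_
    refine Eq.trans ?_ ((hA f (fun _ => 1) g).trans (Finset.sum_congr rfl fun t _ => by ring))
    simp only [mul_one]
  · refine Eq.trans ?_ ((hB b d a).trans (Finset.sum_congr rfl fun t _ => by ring))
    exact congrArg P.ex (funext fun y => by ring)
  · refine h.card_le_of_ex_eq_sum hP hF hij hi hj (A := A₀)
      (B := fun t g => A₁ t g * A₂ t fun _ => 1) fun f g => ?_
    refine Eq.trans ?_ ((hA (fun _ => 1) f g).trans (Finset.sum_congr rfl fun t _ => by ring))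
    simp only [one_mul]

/-- A tensor decomposition with as many terms as the common latent parent of `i` and `s` has values
makes two further observed variables independent given that parent. -/
theorem IsDiscreteLSM.condIndep_of_ex_eq_sum (h : IsDiscreteLSM G c P) (hP : IsMarkov G P)
    (hF : ∀ x, FullRankAt G P (Sum.inr x)) {l : L} {i j k s : X} (hij : i ≠ j) (hik : i ≠ k)
    (his : i ≠ s) (hjs : j ≠ s) (hks : k ≠ s)
    (hi : G.Adj (Sum.inl l) (Sum.inr i)) (hs : G.Adj (Sum.inl l) (Sum.inr s)) {R : ℕ}
    (hR : R ≤ c (Sum.inl l))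
    {A₀ : Fin R → (Fin (c (Sum.inr i)) → ℝ) → ℝ} {A₁ : Fin R → (Fin (c (Sum.inr j)) → ℝ) → ℝ}
    {A₂ : Fin R → (Fin (c (Sum.inr k)) → ℝ) → ℝ} {A₃ : Fin R → (Fin (c (Sum.inr s)) → ℝ) → ℝ}
    (hA : ∀ f₀ f₁ f₂ f₃, P.ex (fun y => f₀ (y (Sum.inr i)) * f₁ (y (Sum.inr j)) *
      f₂ (y (Sum.inr k)) * f₃ (y (Sum.inr s))) = ∑ t, A₀ t f₀ * A₁ t f₁ * A₂ t f₂ * A₃ t f₃) :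
    P.CondIndep {Sum.inr j} {Sum.inr k} {Sum.inl l} := by
  obtain ⟨φ, hφ⟩ := h.exists_test hP hi (hF i)
  obtain ⟨ψ, hψ⟩ := h.exists_test hP hs (hF s)
  let M : Fin (c (Sum.inl l)) → (Fin (c (Sum.inr j)) → ℝ) → (Fin (c (Sum.inr k)) → ℝ) → ℝ :=
    fun b f g => P.ex fun y => ind (Sum.inl l) b y * (f (y (Sum.inr j)) * g (y (Sum.inr k)))
  -- The tests on `i` and `s` select values `b` and `b'` of the same latent variable, so only
  -- diagonal blocks survive.
  have key : ∀ b b' f g, ∑ t, A₀ t (φ b) * A₁ t f * A₂ t g * A₃ t (ψ b') =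
      if b = b' then M b f g else 0 := by
    intro b b' f g
    rw [← hA]
    simp only [mul_assoc]
    rw [hφ b _ (dependsOn_mul (dependsOn_compl (by simpa using hij.symm))
      (dependsOn_mul (dependsOn_compl (by simpa using hik.symm))
        (dependsOn_compl (by simpa using his.symm))))]
    have e : (fun y : Config c => ind (Sum.inl l) b y * (f (y (Sum.inr j)) *
        (g (y (Sum.inr k)) * ψ b' (y (Sum.inr s))))) = fun y => ψ b' (y (Sum.inr s)) *
        (ind (Sum.inl l) b y * (f (y (Sum.inr j)) * g (y (Sum.inr k)))) := by
      funext y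
      ring
    rw [e, hψ b' _ (dependsOn_mul (dependsOn_ind_compl (by simp) b)
      (dependsOn_mul (dependsOn_compl (by simpa using hjs))
        (dependsOn_compl (by simpa using hks))))]
    simp only [← mul_assoc (ind _ b' _), mul_comm (ind _ b' _), ind_mul_ind]
    split_ifs
    · rfl
    · simp [JointDist.ex]
  have hM1 : ∀ b, M b (fun _ => 1) (fun _ => 1) = P.ex (ind (Sum.inl l) b) := by
    intro b
    simp [M]
  have minor : ∀ b f g, M b f g * M b (fun _ => 1) (fun _ => 1) =
      M b f (fun _ => 1) * M b (fun _ => 1) g := by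
    intro b f g
    by_contra hne
    -- One row per block, plus a second row in block `b` coming from `f`: more than `R` rows in all,
    -- hence dependent.
    let U : Option (Fin (c (Sum.inl l))) → Fin R → ℝ := fun o t => o.elim
      (A₀ t (φ b) * A₁ t f) fun b' => A₀ t (φ b') * A₁ t fun _ => 1
    obtain ⟨γ, hγ0, hγ⟩ := exists_relation_of_lt_card
      (by simpa [Fintype.card_option] using Nat.lt_succ_of_le hR) U
    have rel : ∀ b' g', (if b = b' then γ none * M b f g' else 0) +
        γ (some b') * M b' (fun _ => 1) g' = 0 := by
      intro b' g'
      have h1 : ∑ o, γ o * ∑ t, U o t * (A₂ t g' * A₃ t (ψ b')) = 0 := by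
        simp only [Finset.mul_sum]
        rw [Finset.sum_comm]
        refine Finset.sum_eq_zero fun t _ => ?_
        simp only [← mul_assoc (γ _)]
        rw [← Finset.sum_mul, hγ, zero_mul]
      rw [Fintype.sum_option] at h1
      simp only [U, Option.elim, ← mul_assoc (_ * _)] at h1
      simpa only [key, mul_ite, mul_zero, Finset.sum_ite_eq', Finset.mem_univ, if_true] using h1
    have r1 := rel b fun _ => 1
    have r2 := rel b g
    rw [if_pos rfl] at r1 r2
    -- Within block `b`, a nonvanishing 2×2 minor kills the extra coefficient. The others then die
    -- because each `P(l = b')` is positive.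
    have hnone : γ none = 0 := by
      have : γ none * (M b f g * M b (fun _ => 1) (fun _ => 1) -
          M b f (fun _ => 1) * M b (fun _ => 1) g) = 0 := by
        linear_combination M b (fun _ => 1) (fun _ => 1) * r2 - M b (fun _ => 1) g * r1
      exact (mul_eq_zero.1 this).resolve_right (sub_ne_zero.2 hne)
    refine hγ0 (funext fun o => ?_)
    rcases o with _ | b'
    · exact hnone
    · have r3 := rel b' fun _ => 1
      rw [hnone, zero_mul, ite_self, zero_add, hM1] at r3
      exact (mul_eq_zero.1 r3).resolve_right (h.ex_ind_pos _ _).ne'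
  intro x
  have hm := minor (x (Sum.inl l)) (fun a => if a = x (Sum.inr j) then 1 else 0)
    (fun a => if a = x (Sum.inr k) then 1 else 0)
  simp only [JointDist.marg_eq_ex, allInd_union, allInd_singleton_eq_ind]
  simp only [M, mul_one, one_mul] at hm
  refine Eq.trans ?_ (hm.trans ?_)
  · congr 2
    funext y
    simp only [ind]
    ring
  · congr 2
    · funext y
      simp only [ind]
      ring
    · funext y
      simp only [ind]
      ring

end Model

/-! ### Graphical consequences of the conditional independence of cluster members -/

section Graph

variable {V : Type*} {G : Digraph V} [Fintype V] [DecidableEq V]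

theorem Entails.symm {A B C : Set V} (h : Entails G A B C) : Entails G B A C := by
  intro c P hP x
  rw [Set.union_comm B A, h c P hP x, mul_comm]

/-- A path from `li` to `xj` avoiding `lk` makes `li` a common source of `xi` and `xj`, against
`ek`. If it meets `lk`, acyclicity keeps the remainder off `li`, and `lk` is a common source of `xj`
and `xk`, against `ei`. -/
theorem not_reach_of_entails (hG : Acyclic G) {li lk xi xj xk : V} (hi : G.Adj li xi)
    (hk : G.Adj lk xk) (hik : li ≠ lk) (hxi : xi ≠ lk) (hxk : xk ≠ li)
    (ei : Entails G {xj} {xk} {li}) (ek : Entails G {xi} {xj} {lk}) :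
    ¬ Relation.ReflTransGen G.Adj li xj := by
  intro h
  rcases reach_avoiding_or lk h with h1 | ⟨h1, h2⟩
  · exact not_entails_of_reach_avoiding hik (Relation.ReflTransGen.single ⟨hi, hxi⟩) h1 ek
  · rcases reach_avoiding_or li h2 with h3 | ⟨h3, -⟩
    · exact not_entails_of_reach_avoiding hik.symm h3
        (Relation.ReflTransGen.single ⟨hk, hxk⟩) ei
    · exact hik (hG.eq_of_reach h1 h3)

/-- By `ei`, the paths from `t` cannot both avoid `li`; yet `li` reaches neither `xj` nor `xk`. -/
theorem not_common_ancestor_of_entails (hG : Acyclic G) {li lj lk xi xj xk : V}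
    (hi : G.Adj li xi) (hj : G.Adj lj xj) (hk : G.Adj lk xk) (hij : li ≠ lj) (hik : li ≠ lk)
    (hxij : xi ≠ lj) (hxik : xi ≠ lk) (hxji : xj ≠ li) (hxki : xk ≠ li)
    (ei : Entails G {xj} {xk} {li}) (ej : Entails G {xi} {xk} {lj}) (ek : Entails G {xi} {xj} {lk})
    {t : V} (htj : Relation.ReflTransGen G.Adj t xj) (htk : Relation.ReflTransGen G.Adj t xk) :
    False := by
  have hj' := not_reach_of_entails hG hi hk hik hxik hxki ei ek
  have hk' := not_reach_of_entails hG hi hj hij hxij hxji ei.symm ej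
  rcases reach_avoiding_or li htj with h1 | ⟨-, h1⟩
  · rcases reach_avoiding_or li htk with h2 | ⟨-, h2⟩
    · refine not_entails_of_reach_avoiding (fun h => ?_) h1 h2 ei
      subst h
      exact hj' htj
    · exact hk' h2
  · exact hj' h1

theorem parents_ne_of_entails {li lj lk xj xk : V} (hj : G.Adj lj xj) (hk : G.Adj lk xk)
    (hji : lj ≠ li) (hxj : xj ≠ li) (hxk : xk ≠ li) (ei : Entails G {xj} {xk} {li}) :
    lj ≠ lk := by
  rintro rfl
  exact not_entails_of_reach_avoiding hji (Relation.ReflTransGen.single ⟨hj, hxj⟩)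
    (Relation.ReflTransGen.single ⟨hk, hxk⟩) ei

theorem IsMarkov.ex_ind_mul_three (hG : Acyclic G) {c : V → ℕ} {P : JointDist c}
    (hP : IsMarkov G P) {x y z : V}
    (hxy : ∀ t, Relation.ReflTransGen G.Adj t x → ¬ Relation.ReflTransGen G.Adj t y)
    (hxz : ∀ t, Relation.ReflTransGen G.Adj t x → ¬ Relation.ReflTransGen G.Adj t z)
    (hyz : ∀ t, Relation.ReflTransGen G.Adj t y → ¬ Relation.ReflTransGen G.Adj t z)
    (a : Fin (c x)) (b : Fin (c y)) (d : Fin (c z)) :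
    P.ex (fun w => ind x a w * ind y b w * ind z d w) =
      P.ex (ind x a) * P.ex (ind y b) * P.ex (ind z d) := by
  have anc : ∀ v (a : Fin (c v)),
      DependsOn (ind (c := c) v a) {t | Relation.ReflTransGen G.Adj t v} := fun v a =>
    dependsOn_subset (dependsOn_ind v a)
      (Set.singleton_subset_iff.2 (Relation.ReflTransGen.refl : Relation.ReflTransGen G.Adj v v))
  have closed : ∀ w u v, G.Adj u v → v ∈ {t | Relation.ReflTransGen G.Adj t w} →
      u ∈ {t | Relation.ReflTransGen G.Adj t w} := fun w u v huv hv =>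
    Relation.ReflTransGen.head huv hv
  have h1 := IsMarkov.ex_mul_of_ancestral hG hP (closed y) (closed z)
    (Set.disjoint_left.2 hyz) (anc y b) (anc z d)
  have h2 := IsMarkov.ex_mul_of_ancestral hG hP (closed x)
    (B := {t | Relation.ReflTransGen G.Adj t y} ∪ {t | Relation.ReflTransGen G.Adj t z})
    (fun u v huv hv => hv.imp (closed y u v huv) (closed z u v huv))
    (Set.disjoint_left.2 fun t ht ht' => ht'.elim (hxy t ht) (hxz t ht)) (anc x a)
    (dependsOn_mul (dependsOn_subset (anc y b) Set.subset_union_left)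
      (dependsOn_subset (anc z d) Set.subset_union_right))
  simp only [mul_assoc]
  rw [h2, h1]

end Graph

/-! ### Rule 2: from four-way ranks to a causal cluster -/

section Model

variable {L X : Type*} [Fintype L] [DecidableEq L] [Fintype X] [DecidableEq X]
  {G : Digraph (L ⊕ X)} {c : L ⊕ X → ℕ} {P : JointDist c}

/-- Otherwise the at least three children of `l` would all lie in `{i, j, k}`, hence exhaust it and
make it a cluster. -/
theorem IsDiscreteLSM.exists_fourth_child (h : IsDiscreteLSM G c P) {l : L} {i j k : X}
    (hl : ¬ IsCausalCluster G {i, j, k}) :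
    ∃ s, s ≠ i ∧ s ≠ j ∧ s ≠ k ∧ G.Adj (Sum.inl l) (Sum.inr s) := by
  by_contra hne
  push Not at hne
  have hsub : {x : X | G.Adj (Sum.inl l) (Sum.inr x)} ⊆ {i, j, k} := by
    intro s hs
    by_contra hs'
    simp only [Set.mem_insert_iff, Set.mem_singleton_iff, not_or] at hs'
    exact hne s hs'.1 hs'.2.1 hs'.2.2 hs
  have hcard : ({i, j, k} : Set X).ncard ≤ 3 := by
    refine (Set.ncard_insert_le _ _).trans (Nat.succ_le_succ ?_)
    refine (Set.ncard_insert_le _ _).trans (Nat.succ_le_succ ?_)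
    rw [Set.ncard_singleton]
  have heq := Set.eq_of_subset_of_ncard_le hsub (hcard.trans (h.three_children l))
  refine hl ⟨l, fun x hx => ?_⟩
  rw [← heq] at hx
  exact hx

theorem IsDiscreteLSM.entails_of_tensorRank (h : IsDiscreteLSM G c P) (hP : IsMarkov G P)
    (hFaith : IsFaithful G P) (hF : ∀ x, FullRankAt G P (Sum.inr x)) {r : ℕ}
    (hr : ∀ l : L, c (Sum.inl l) = r) {i j k : X} (hij : i ≠ j) (hik : i ≠ k) (hjk : j ≠ k)
    (hcl : ¬ IsCausalCluster G {i, j, k})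
    (hrank : ∀ s : X, s ≠ i → s ≠ j → s ≠ k →
      tensorRank (P.tensor ![Sum.inr i, Sum.inr j, Sum.inr k, Sum.inr s]) = r) {li lj lk : L}
    (hi : G.Adj (Sum.inl li) (Sum.inr i)) (hj : G.Adj (Sum.inl lj) (Sum.inr j))
    (hk : G.Adj (Sum.inl lk) (Sum.inr k)) :
    Entails G {Sum.inr j} {Sum.inr k} {Sum.inl li} ∧
    Entails G {Sum.inr i} {Sum.inr k} {Sum.inl lj} ∧
    Entails G {Sum.inr i} {Sum.inr j} {Sum.inl lk} := by
  have dec : ∀ s : X, s ≠ i → s ≠ j → s ≠ k → _ := fun s h1 h2 h3 =>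
    P.exists_ex_eq_sum_four (exists_eq_sum_of_tensorRank_eq (hrank s h1 h2 h3)
      (by have := h.two_le_card (Sum.inl li); rw [hr] at this; omega))
  refine ⟨hFaith _ _ _ (by simpa using hjk) (by simp) (by simp) ?_,
    hFaith _ _ _ (by simpa using hik) (by simp) (by simp) ?_,
    hFaith _ _ _ (by simpa using hij) (by simp) (by simp) ?_⟩
  · obtain ⟨s, hsi, hsj, hsk, hs⟩ := h.exists_fourth_child (l := li) hcl
    obtain ⟨A₀, A₁, A₂, A₃, hA⟩ := dec s hsi hsj hsk
    exact h.condIndep_of_ex_eq_sum hP hF hij hik hsi.symm hsj.symm hsk.symm hi hs (hr li).ge hA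
  · obtain ⟨s, hsi, hsj, hsk, hs⟩ := h.exists_fourth_child (l := lj) hcl
    obtain ⟨A₀, A₁, A₂, A₃, hA⟩ := dec s hsi hsj hsk
    refine h.condIndep_of_ex_eq_sum hP hF hij.symm hjk hsj.symm hsi.symm hsk.symm hj hs
      (hr lj).ge (A₀ := A₁) (A₁ := A₀) (A₂ := A₂) (A₃ := A₃) fun f₀ f₁ f₂ f₃ => ?_
    refine Eq.trans (congrArg P.ex (funext fun y => by ring))
      ((hA f₁ f₀ f₂ f₃).trans (Finset.sum_congr rfl fun t _ => by ring))
  · obtain ⟨s, hsi, hsj, hsk, hs⟩ := h.exists_fourth_child (l := lk) hcl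
    obtain ⟨A₀, A₁, A₂, A₃, hA⟩ := dec s hsi hsj hsk
    refine h.condIndep_of_ex_eq_sum hP hF hik.symm hjk.symm hsk.symm hsi.symm hsj.symm hk hs
      (hr lk).ge (A₀ := A₂) (A₁ := A₀) (A₂ := A₁) (A₃ := A₃) fun f₀ f₁ f₂ f₃ => ?_
    refine Eq.trans (congrArg P.ex (funext fun y => by ring))
      ((hA f₁ f₂ f₀ f₃).trans (Finset.sum_congr rfl fun t _ => by ring))

theorem IsDiscreteLSM.isCausalCluster_of_tensorRank (h : IsDiscreteLSM G c P) (hP : IsMarkov G P)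
    (hFaith : IsFaithful G P) (hF : ∀ x, FullRankAt G P (Sum.inr x)) {r : ℕ}
    (hr : ∀ l : L, c (Sum.inl l) = r) {i j k : X} (hij : i ≠ j) (hik : i ≠ k) (hjk : j ≠ k)
    (hone : tensorRank (P.tensor ![Sum.inr i, Sum.inr j, Sum.inr k]) ≠ 1)
    (hrank : ∀ s : X, s ≠ i → s ≠ j → s ≠ k →
      tensorRank (P.tensor ![Sum.inr i, Sum.inr j, Sum.inr k, Sum.inr s]) = r) :
    IsCausalCluster G {i, j, k} := by
  by_contra hcl
  obtain ⟨li, hi, -⟩ := h.pure_observed i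
  obtain ⟨lj, hj, -⟩ := h.pure_observed j
  obtain ⟨lk, hk, -⟩ := h.pure_observed k
  obtain ⟨ei, ej, ek⟩ := h.entails_of_tensorRank hP hFaith hF hr hij hik hjk hcl hrank hi hj hk
  have hne : ¬ (li = lj ∧ li = lk) := by
    rintro ⟨rfl, rfl⟩
    refine hcl ⟨li, fun x hx => ?_⟩
    rcases hx with rfl | rfl | rfl
    exacts [hi, hj, hk]
  have inl_ne {l l' : L} : (Sum.inl l : L ⊕ X) ≠ Sum.inl l' ↔ l ≠ l' := Sum.inl_injective.ne_iff
  -- Two equal parents distinct from the third would violate the relation conditioned on the third.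
  -- Since not all three coincide, they are pairwise distinct.
  have pi : lj ≠ li → lj ≠ lk := fun h' => inl_ne.1
    (parents_ne_of_entails hj hk (inl_ne.2 h') Sum.inr_ne_inl Sum.inr_ne_inl ei)
  have pj : li ≠ lj → li ≠ lk := fun h' => inl_ne.1
    (parents_ne_of_entails hi hk (inl_ne.2 h') Sum.inr_ne_inl Sum.inr_ne_inl ej)
  have pk : li ≠ lk → li ≠ lj := fun h' => inl_ne.1
    (parents_ne_of_entails hi hj (inl_ne.2 h') Sum.inr_ne_inl Sum.inr_ne_inl ek)
  have nij : li ≠ lj := by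
    by_cases hlk : li = lk
    · exact fun h' => hne ⟨h', hlk⟩
    · exact pk hlk
  have nik := inl_ne.2 (pj nij)
  have njk := inl_ne.2 (pi nij.symm)
  replace nij := inl_ne.2 nij
  have key := IsMarkov.ex_ind_mul_three h.acyclic hP (x := Sum.inr i) (y := Sum.inr j)
    (z := Sum.inr k)
    (fun t hti htj => not_common_ancestor_of_entails h.acyclic hk hi hj nik.symm njk.symm
      Sum.inr_ne_inl Sum.inr_ne_inl Sum.inr_ne_inl Sum.inr_ne_inl ek ei.symm ej.symm hti htj)
    (fun t hti htk => not_common_ancestor_of_entails h.acyclic hj hi hk nij.symm njk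
      Sum.inr_ne_inl Sum.inr_ne_inl Sum.inr_ne_inl Sum.inr_ne_inl ej ei ek.symm hti htk)
    (fun t htj htk => not_common_ancestor_of_entails h.acyclic hi hj hk nij nik
      Sum.inr_ne_inl Sum.inr_ne_inl Sum.inr_ne_inl Sum.inr_ne_inl ei ej ek htj htk)
  refine hone (P.tensorRank_eq_one_of_indep _ fun a => ?_)
  simp only [Fin.prod_univ_three]
  exact key (a 0) (a 1) (a 2)

end Model

end DiscreteLSM

end

theorem proposition2 {L X : Type*} [Fintype L] [DecidableEq L] [Fintype X] [DecidableEq X]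
    (G : Digraph (L ⊕ X)) (c : L ⊕ X → ℕ) (P : DiscreteLSM.JointDist c)
    (hLSM : DiscreteLSM.IsDiscreteLSM G c P)
    (hMarkov : DiscreteLSM.IsMarkov G P)
    (hFaithful : DiscreteLSM.IsFaithful G P)
    (hFullRank : ∀ x : X, DiscreteLSM.FullRankAt G P (Sum.inr x))
    (r : ℕ) (hr : ∀ l : L, c (Sum.inl l) = r)
    (i j k : X) (hij : i ≠ j) (hik : i ≠ k) (hjk : j ≠ k) :
    -- Rule 1
    (DiscreteLSM.tensorRank (P.tensor ![Sum.inr i, Sum.inr j, Sum.inr k]) ≠ r →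
      ¬ DiscreteLSM.IsCausalCluster G {i, j, k} ∧
        ¬ DiscreteLSM.IsCausalCluster G {i, j} ∧
        ¬ DiscreteLSM.IsCausalCluster G {i, k} ∧
        ¬ DiscreteLSM.IsCausalCluster G {j, k}) ∧
    -- Rule 2
    (DiscreteLSM.tensorRank (P.tensor ![Sum.inr i, Sum.inr j, Sum.inr k]) ≠ 1 →
      (∀ s : X, s ≠ i → s ≠ j → s ≠ k →
        DiscreteLSM.tensorRank
          (P.tensor ![Sum.inr i, Sum.inr j, Sum.inr k, Sum.inr s]) = r) →
      DiscreteLSM.IsCausalCluster G {i, j, k}) := by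
  refine ⟨fun hne => ?_, fun hone hrank => hLSM.isCausalCluster_of_tensorRank hMarkov hFaithful
    hFullRank hr hij hik hjk hone hrank⟩
  -- The pair sharing a parent may sit in any two of the three tensor modes, whence the three
  -- orderings in `tensorRank_three`.
  have h_ij : ¬ DiscreteLSM.IsCausalCluster G {i, j} := fun ⟨l, hl⟩ =>
    hne ((hLSM.tensorRank_three hMarkov hFullRank hij hik hjk (hl i (by simp))
      (hl j (by simp))).1.trans (hr l))
  refine ⟨fun ⟨l, hl⟩ => h_ij ⟨l, fun x hx => hl x ?_⟩, h_ij, fun ⟨l, hl⟩ => ?_, fun ⟨l, hl⟩ => ?_⟩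
  · rcases hx with rfl | rfl <;> simp
  · exact hne ((hLSM.tensorRank_three hMarkov hFullRank hik hij hjk.symm (hl i (by simp))
      (hl k (by simp))).2.1.trans (hr l))
  · exact hne ((hLSM.tensorRank_three hMarkov hFullRank hjk hij.symm hik.symm (hl j (by simp))
      (hl k (by simp))).2.2.trans (hr l))
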